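/- Let $\mathcal A$ be a Desargues affine plane, i.e. a set of points with a family of subsets called lines such that: any two distinct points lie on exactly one line; for each point $P$ and line $\ell$ with $P\notin\ell$ there is exactly one line through $P$ disjoint from $\ell$; there are three non-collinear points; and Desargues' axiom holds (for pairwise distinct lines $a,b,c$ that are parallel, or that have a common point $V$, and points $A,A'\in a$, $B,B'\in b$, $C,C'\in c$, all different from $V$ in the second case, $AB\parallel A'B'$ and $BC\parallel B'C'$ imply $AC\parallel A'C'$). Lines are called parallel if they are equal or disjoint. Let $O\neq I$ be two points and let $\ell^{OI}$ be the line through them. For $A,B\in\ell^{OI}$ choose an auxiliary point $B_1\notin\ell^{OI}$. The sum $A+B$ is the intersection of $\ell^{OI}$ with the parallel to $BB_1$ through $P_1$, where $P_1$ is the intersection of the parallel to $\ell^{OI}$ through $B_1$ and the parallel to $OB_1$ through $A$. The product $A\cdot B$ is the intersection of $\ell^{OI}$ with the parallel to $BB_1$ through $P_1$, where now $P_1$ is the intersection of the line $OB_1$ and the parallel to $IB_1$ through $A$. (These points do not depend on $B_1$, and $(\ell^{OI},+,\cdot)$ is a skew field with zero $O$ and unit $I$.) Write $-A$ for the opposite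 of $A$, $A^{-1}$ for the inverse of $A\neq O$, and $A-B=A+(-B)$. For $A,B,C,D\in\ell^{OI}$ with $A\neq D$ and $B\neq C$, the cross-ratio is the point $$c_r(A,B;C,D)=\left[(A-D)^{-1}(B-D)\right]\left[(B-C)^{-1}(A-C)\right].$$ For $P\in\ell^{OI}$ the natural translation with the point $P$ is the map $\varphi_P:\ell^{OI}\to\ell^{OI}$, $\varphi_P(A)=P+A$. **Theorem.** Cross-ratios are invariant under natural translations: for all $P,A,B,C,D\in\ell^{OI}$ with $A\ne D$ and $B\neq C$, we have $\varphi_P(A)\neq\varphi_P(D)$ and $\varphi_P(B)\neq\varphi_P(C)$, and $$c_r(\varphi_P(A),\varphi_P(B);\varphi_P(C),\varphi_P(D))=c_r(A+P,B+P;C+P,D+P)=c_r(A,B;C,D).$$ -/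

import Mathlib

/-- An affine plane: points, lines as sets of points, a unique line through two distinct points,
the Playfair axiom, and three non-collinear points. -/
structure AffinePlane (Pt : Type*) where
  /-- the family of lines -/
  lines : Set (Set Pt)
  exists_unique_line : ∀ X Y : Pt, X ≠ Y → ∃! l : Set Pt, l ∈ lines ∧ X ∈ l ∧ Y ∈ l
  playfair : ∀ (X : Pt) (l : Set Pt), l ∈ lines → X ∉ l →
    ∃! m : Set Pt, m ∈ lines ∧ X ∈ m ∧ l ∩ m = ∅
  exists_noncollinear : ∃ X Y Z : Pt, ∀ l ∈ lines, ¬ (X ∈ l ∧ Y ∈ l ∧ Z ∈ l)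

namespace AffinePlane

variable {Pt : Type*} (𝒜 : AffinePlane Pt)

/-- Two lines are parallel when they are equal or have no common point. -/
def Parallel (l m : Set Pt) : Prop := l = m ∨ l ∩ m = ∅

open Classical in
/-- The line through two distinct points (the value for equal points is irrelevant). -/
noncomputable def join (X Y : Pt) : Set Pt :=
  if h : X ≠ Y then (𝒜.exists_unique_line X Y h).choose else {X}

theorem join_spec {X Y : Pt} (h : X ≠ Y) :
    𝒜.join X Y ∈ 𝒜.lines ∧ X ∈ 𝒜.join X Y ∧ Y ∈ 𝒜.join X Y := by
  unfold join
  rw [dif_pos h]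
  exact (𝒜.exists_unique_line X Y h).choose_spec.1

theorem line_eq {X Y : Pt} (h : X ≠ Y) {l m : Set Pt} (hl : l ∈ 𝒜.lines) (hm : m ∈ 𝒜.lines)
    (hXl : X ∈ l) (hYl : Y ∈ l) (hXm : X ∈ m) (hYm : Y ∈ m) : l = m :=
  (𝒜.exists_unique_line X Y h).unique ⟨hl, hXl, hYl⟩ ⟨hm, hXm, hYm⟩

theorem exists_par (l : Set Pt) (X : Pt) (hl : l ∈ 𝒜.lines) :
    ∃ m : Set Pt, m ∈ 𝒜.lines ∧ X ∈ m ∧ Parallel m l := by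
  by_cases hX : X ∈ l
  · exact ⟨l, hl, hX, Or.inl rfl⟩
  · obtain ⟨m, ⟨hm, hXm, hd⟩, -⟩ := 𝒜.playfair X l hl hX
    exact ⟨m, hm, hXm, Or.inr (by rw [Set.inter_comm]; exact hd)⟩

open Classical in
/-- The line through the point `X` parallel to the line `l`
(the value when `l` is not a line is irrelevant). -/
noncomputable def par (l : Set Pt) (X : Pt) : Set Pt :=
  if hl : l ∈ 𝒜.lines then (𝒜.exists_par l X hl).choose else {X}

theorem par_spec {l : Set Pt} (X : Pt) (hl : l ∈ 𝒜.lines) :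
    𝒜.par l X ∈ 𝒜.lines ∧ X ∈ 𝒜.par l X ∧ Parallel (𝒜.par l X) l := by
  unfold par
  rw [dif_pos hl]
  exact (𝒜.exists_par l X hl).choose_spec

theorem eq_of_parallel {l m : Set Pt} {X : Pt} (h : Parallel l m) (hl : X ∈ l) (hm : X ∈ m) :
    l = m := by
  rcases h with h | h
  · exact h
  · exact absurd (show X ∈ l ∩ m from ⟨hl, hm⟩) (by rw [h]; exact Set.notMem_empty X)

theorem parallel_symm {l m : Set Pt} (h : Parallel l m) : Parallel m l := by
  rcases h with h | h
  · exact Or.inl h.symm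
  · exact Or.inr (by rw [Set.inter_comm]; exact h)

theorem parallel_trans {l m n : Set Pt} (hl : l ∈ 𝒜.lines) (hm : m ∈ 𝒜.lines)
    (hn : n ∈ 𝒜.lines) (h₁ : Parallel l m) (h₂ : Parallel m n) : Parallel l n := by
  rcases h₁ with rfl | h₁
  · exact h₂
  rcases h₂ with rfl | h₂
  · exact Or.inr h₁
  by_cases hd : l ∩ n = ∅
  · exact Or.inr hd
  obtain ⟨X, hXl, hXn⟩ := Set.nonempty_iff_ne_empty.2 hd
  have hXm : X ∉ m := fun hXm => by
    have : X ∈ l ∩ m := ⟨hXl, hXm⟩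
    rw [h₁] at this
    exact this
  exact Or.inl ((𝒜.playfair X m hm hXm).unique
    ⟨hl, hXl, by rw [Set.inter_comm]; exact h₁⟩ ⟨hn, hXn, h₂⟩)

/-- Lines parallel to two distinct intersecting lines intersect. -/
theorem exists_meet {l m l' m' : Set Pt} {X : Pt} (hl : l ∈ 𝒜.lines) (hm : m ∈ 𝒜.lines)
    (hl' : l' ∈ 𝒜.lines) (hm' : m' ∈ 𝒜.lines) (hXl : X ∈ l) (hXm : X ∈ m) (hne : l ≠ m)
    (h₁ : Parallel l' l) (h₂ : Parallel m' m) : ∃ Y, Y ∈ l' ∧ Y ∈ m' := by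
  by_contra hcon
  have hd : Parallel l' m' := Or.inr (by
    ext Y
    simp only [Set.mem_inter_iff, Set.mem_empty_iff_false, iff_false]
    exact fun hY => hcon ⟨Y, hY⟩)
  have h₃ : Parallel l m :=
    𝒜.parallel_trans hl hl' hm (parallel_symm h₁) (𝒜.parallel_trans hl' hm' hm hd h₂)
  exact hne (eq_of_parallel h₃ hXl hXm)

/-- Desargues' axiom. Let `a`, `b`, `c` be pairwise distinct lines which are parallel, or which
pass through a common point `V`, and let `A, A'`, `B, B'`, `C, C'` be points on `a`, `b`, `c`
respectively (different from `V` in the second case). If `AB ∥ A'B'` and `BC ∥ B'C'`, then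
`AC ∥ A'C'`. -/
def IsDesarguesian : Prop :=
  ∀ a ∈ 𝒜.lines, ∀ b ∈ 𝒜.lines, ∀ c ∈ 𝒜.lines, a ≠ b → b ≠ c → a ≠ c →
    ∀ A ∈ a, ∀ A' ∈ a, ∀ B ∈ b, ∀ B' ∈ b, ∀ C ∈ c, ∀ C' ∈ c,
      ((Parallel a b ∧ Parallel b c) ∨
        ∃ V, V ∈ a ∧ V ∈ b ∧ V ∈ c ∧
          A ≠ V ∧ A' ≠ V ∧ B ≠ V ∧ B' ≠ V ∧ C ≠ V ∧ C' ≠ V) →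
      Parallel (𝒜.join A B) (𝒜.join A' B') →
      Parallel (𝒜.join B C) (𝒜.join B' C') →
      Parallel (𝒜.join A C) (𝒜.join A' C')

/-- Two distinct points `O` (zero) and `I` (unit) of the plane. -/
structure Frame {Pt : Type*} (_𝒜 : AffinePlane Pt) where
  /-- the zero point -/
  O : Pt
  /-- the unit point -/
  I : Pt
  ne : O ≠ I

namespace Frame

variable {𝒜} (F : 𝒜.Frame)

/-- The line `OI`. -/
noncomputable def line : Set Pt := 𝒜.join F.O F.I

/-- The points of the line `OI`. -/
abbrev LinePt : Type _ := {X : Pt // X ∈ F.line}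

/-- `C` is obtained from `A`, `B` by the addition construction, for some auxiliary point `B₁` off
the line `OI`: the parallel to `OI` through `B₁` meets the parallel to `OB₁` through `A` in `P₁`,
and the parallel to `BB₁` through `P₁` meets `OI` in `C`. -/
def IsSum (A B C : F.LinePt) : Prop :=
  ∃ B₁ P₁ : Pt, B₁ ∉ F.line ∧
    P₁ ∈ 𝒜.par F.line B₁ ∧ P₁ ∈ 𝒜.par (𝒜.join F.O B₁) A ∧
    C.1 ∈ 𝒜.par (𝒜.join B B₁) P₁

/-- `C` is obtained from `A`, `B` by the multiplication construction, for some auxiliary point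
`B₁` off the line `OI`: the parallel to `IB₁` through `A` meets `OB₁` in `P₁`, and the parallel to
`BB₁` through `P₁` meets `OI` in `C`. -/
def IsProd (A B C : F.LinePt) : Prop :=
  ∃ B₁ P₁ : Pt, B₁ ∉ F.line ∧
    P₁ ∈ 𝒜.par (𝒜.join F.I B₁) A ∧ P₁ ∈ 𝒜.join F.O B₁ ∧
    C.1 ∈ 𝒜.par (𝒜.join B B₁) P₁

instance : Zero F.LinePt := ⟨⟨F.O, (𝒜.join_spec F.ne).2.1⟩⟩

instance : One F.LinePt := ⟨⟨F.I, (𝒜.join_spec F.ne).2.2⟩⟩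

theorem line_mem : F.line ∈ 𝒜.lines := (𝒜.join_spec F.ne).1

theorem O_mem : F.O ∈ F.line := (𝒜.join_spec F.ne).2.1

theorem I_mem : F.I ∈ F.line := (𝒜.join_spec F.ne).2.2

theorem exists_notMem_line : ∃ B₁, B₁ ∉ F.line := by
  obtain ⟨X, Y, Z, h⟩ := 𝒜.exists_noncollinear
  by_contra hcon
  push Not at hcon
  exact h F.line F.line_mem ⟨hcon X, hcon Y, hcon Z⟩

variable {F} in
theorem join_aux {X B₁ : Pt} (hX : X ∈ F.line) (hB : B₁ ∉ F.line) :
    𝒜.join X B₁ ∈ 𝒜.lines ∧ X ∈ 𝒜.join X B₁ ∧ B₁ ∈ 𝒜.join X B₁ ∧ 𝒜.join X B₁ ≠ F.line := by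
  have hne : X ≠ B₁ := fun h => hB (h ▸ hX)
  obtain ⟨h₁, h₂, h₃⟩ := 𝒜.join_spec hne
  exact ⟨h₁, h₂, h₃, fun h => hB (h ▸ h₃)⟩

variable {F} in
theorem exists_last {B B₁ : Pt} (P₁ : Pt) (hB : B ∈ F.line) (hB₁ : B₁ ∉ F.line) :
    ∃ C : F.LinePt, C.1 ∈ 𝒜.par (𝒜.join B B₁) P₁ := by
  obtain ⟨h₁, h₂, -, h₄⟩ := join_aux hB hB₁
  obtain ⟨h₅, -, h₆⟩ := 𝒜.par_spec P₁ h₁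
  obtain ⟨C, hC, hC'⟩ :=
    𝒜.exists_meet h₁ F.line_mem h₅ F.line_mem h₂ hB h₄ h₆ (Or.inl rfl)
  exact ⟨⟨C, hC'⟩, hC⟩

variable {F} in
theorem exists_solve {B₁ P₁ : Pt} (hB₁ : B₁ ∉ F.line) (hP₁ : P₁ ∉ F.line) (Z : F.LinePt) :
    ∃ Y : F.LinePt, Z.1 ∈ 𝒜.par (𝒜.join Y.1 B₁) P₁ := by
  obtain ⟨h₁, h₂, h₃, -⟩ := join_aux Z.2 hP₁
  obtain ⟨h₅, h₆, h₇⟩ := 𝒜.par_spec B₁ h₁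
  obtain ⟨h₈, h₉, h₁₀, h₁₁⟩ := join_aux Z.2 hP₁
  obtain ⟨Y, hY, hY'⟩ :=
    𝒜.exists_meet h₁ F.line_mem h₅ F.line_mem h₂ Z.2 h₁₁ h₇ (Or.inl rfl)
  obtain ⟨k₁, k₂, k₃, -⟩ := join_aux hY' hB₁
  have hYB : Y ≠ B₁ := fun h => hB₁ (h ▸ hY')
  have e₁ : 𝒜.join Y B₁ = 𝒜.par (𝒜.join Z.1 P₁) B₁ := 𝒜.line_eq hYB k₁ h₅ k₂ k₃ hY h₆
  obtain ⟨k₄, k₅, k₆⟩ := 𝒜.par_spec P₁ k₁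
  have e₂ : 𝒜.par (𝒜.join Y B₁) P₁ = 𝒜.join Z.1 P₁ :=
    eq_of_parallel (𝒜.parallel_trans k₄ k₁ h₁ k₆ (by rw [e₁]; exact h₇)) k₅ h₃
  exact ⟨⟨Y, hY'⟩, by rw [e₂]; exact h₂⟩

variable {F} in
theorem exists_sum_P {B₁ : Pt} (hB₁ : B₁ ∉ F.line) (A : F.LinePt) :
    ∃ P₁, P₁ ∈ 𝒜.par F.line B₁ ∧ P₁ ∈ 𝒜.par (𝒜.join F.O B₁) A.1 := by
  obtain ⟨h₁, h₂, -, h₄⟩ := join_aux F.O_mem hB₁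
  obtain ⟨k₁, -, k₃⟩ := 𝒜.par_spec B₁ F.line_mem
  obtain ⟨k₄, -, k₆⟩ := 𝒜.par_spec A.1 h₁
  exact 𝒜.exists_meet F.line_mem h₁ k₁ k₄ F.O_mem h₂ h₄.symm k₃ k₆

variable {F} in
theorem exists_prod_P {B₁ : Pt} (hB₁ : B₁ ∉ F.line) (A : F.LinePt) :
    ∃ P₁, P₁ ∈ 𝒜.par (𝒜.join F.I B₁) A.1 ∧ P₁ ∈ 𝒜.join F.O B₁ := by
  obtain ⟨h₁, h₂, h₃, h₄⟩ := join_aux F.O_mem hB₁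
  obtain ⟨i₁, i₂, i₃, i₄⟩ := join_aux F.I_mem hB₁
  obtain ⟨k₁, -, k₃⟩ := 𝒜.par_spec A.1 i₁
  refine 𝒜.exists_meet i₁ h₁ k₁ h₁ i₃ h₃ (fun h => h₄ ?_) k₃ (Or.inl rfl)
  exact 𝒜.line_eq F.ne h₁ F.line_mem h₂ (h ▸ i₂) F.O_mem F.I_mem

theorem exists_isSum (A B : F.LinePt) : ∃ C, F.IsSum A B C := by
  obtain ⟨B₁, hB₁⟩ := F.exists_notMem_line
  obtain ⟨P₁, h₁, h₂⟩ := exists_sum_P hB₁ A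
  obtain ⟨C, hC⟩ := exists_last P₁ B.2 hB₁
  exact ⟨C, B₁, P₁, hB₁, h₁, h₂, hC⟩

theorem exists_isProd (A B : F.LinePt) : ∃ C, F.IsProd A B C := by
  obtain ⟨B₁, hB₁⟩ := F.exists_notMem_line
  obtain ⟨P₁, h₁, h₂⟩ := exists_prod_P hB₁ A
  obtain ⟨C, hC⟩ := exists_last P₁ B.2 hB₁
  exact ⟨C, B₁, P₁, hB₁, h₁, h₂, hC⟩

theorem exists_isSum_zero (A : F.LinePt) : ∃ X, F.IsSum A X 0 := by
  obtain ⟨B₁, hB₁⟩ := F.exists_notMem_line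
  obtain ⟨P₁, h₁, h₂⟩ := exists_sum_P hB₁ A
  obtain ⟨k₁, k₂, k₃⟩ := 𝒜.par_spec B₁ F.line_mem
  have hP₁ : P₁ ∉ F.line := fun h => hB₁ (eq_of_parallel k₃ h₁ h ▸ k₂)
  obtain ⟨X, hX⟩ := exists_solve hB₁ hP₁ (0 : F.LinePt)
  exact ⟨X, B₁, P₁, hB₁, h₁, h₂, hX⟩

theorem exists_isProd_one (A : F.LinePt) (hA : A ≠ 0) : ∃ X, F.IsProd A X 1 := by
  obtain ⟨B₁, hB₁⟩ := F.exists_notMem_line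
  obtain ⟨P₁, h₁, h₂⟩ := exists_prod_P hB₁ A
  obtain ⟨j₁, j₂, j₃, j₄⟩ := join_aux F.O_mem hB₁
  obtain ⟨i₁, i₂, i₃, i₄⟩ := join_aux F.I_mem hB₁
  obtain ⟨k₁, k₂, k₃⟩ := 𝒜.par_spec A.1 i₁
  have hP₁ : P₁ ∉ F.line := fun h => by
    have hO : P₁ = F.O := by
      by_contra hne
      exact j₄ (𝒜.line_eq hne j₁ F.line_mem h₂ j₂ h F.O_mem)
    subst hO
    have hAO : A.1 ≠ F.O := fun e => hA (Subtype.ext e)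
    have e₁ := 𝒜.line_eq hAO k₁ F.line_mem k₂ h₁ A.2 F.O_mem
    rw [e₁] at k₃
    exact i₄ (eq_of_parallel k₃ F.I_mem i₂).symm
  obtain ⟨X, hX⟩ := exists_solve hB₁ hP₁ (1 : F.LinePt)
  exact ⟨X, B₁, P₁, hB₁, h₁, h₂, hX⟩

/- In a plane satisfying Desargues' axiom the constructed points do not depend on the auxiliary
point, and the operations below make the line `OI` a skew field with zero `O` and unit `I`. -/

/-- The sum `A + B` of two points of the line `OI`. -/
noncomputable instance : Add F.LinePt := ⟨fun A B => (F.exists_isSum A B).choose⟩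

/-- The product `A * B` of two points of the line `OI`. -/
noncomputable instance : Mul F.LinePt := ⟨fun A B => (F.exists_isProd A B).choose⟩

/-- The opposite `-A`: the solution `X` of `A + X = O`. -/
noncomputable instance : Neg F.LinePt := ⟨fun A => (F.exists_isSum_zero A).choose⟩

/-- The difference `A - B = A + (-B)`. -/
noncomputable instance : Sub F.LinePt := ⟨fun A B => A + -B⟩

open Classical in
/-- The inverse of a point `A ≠ O`: the solution `X` of `A * X = I`.
The value at `O` is irrelevant. -/
noncomputable instance : Inv F.LinePt :=
  ⟨fun A => if hA : A ≠ 0 then (F.exists_isProd_one A hA).choose else 0⟩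

variable {F}

/-- The cross-ratio of four points of the line `OI`; meaningful when `A ≠ D` and `B ≠ C`. -/
noncomputable def crossRatio (A B C D : F.LinePt) : F.LinePt :=
  ((A - D)⁻¹ * (B - D)) * ((B - C)⁻¹ * (A - C))

/-- The natural translation with the point `P`. -/
noncomputable def natTranslation (P : F.LinePt) : F.LinePt → F.LinePt := fun A => P + A

end Frame

end AffinePlane

/-! The cross-ratio is built from differences only, and `(A + P) - (B + P) = A - B` in any group. So
no law of multiplication is needed; what must be proved is that Desargues' axiom makes addition on
OI a commutative group. Commutativity is what turns `P + A` into `A + P`. Only the axiom for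
parallel lines is used. It shows that the constructed sum does not depend on the auxiliary point
(`sum_aux_unique`). Since any auxiliary point may then be used, stacking two parallelograms gives
associativity (`IsTranslate.trans`). For commutativity, each A on OI is extended to a translation of
the whole plane (`translate`), a map sending lines to parallel lines. Composing the translation by B
with one in another direction gives a dilatation without fixed points; its traces are parallel, and
this forces the translations by A and B to commute (`Frame.add_comm`). -/

namespace AffinePlane

/-! ### Parallelism of pairs of points. -/

variable {Pt : Type*} (𝒜 : AffinePlane Pt)

/-- `X, Y` lie on some line parallel to some line containing `Z, W`. -/
def Para (X Y Z W : Pt) : Prop :=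
  ∃ l ∈ 𝒜.lines, ∃ m ∈ 𝒜.lines, X ∈ l ∧ Y ∈ l ∧ Z ∈ m ∧ W ∈ m ∧ Parallel l m

variable {𝒜}

theorem Para.symm {X Y Z W : Pt} : 𝒜.Para X Y Z W → 𝒜.Para Z W X Y := by
  rintro ⟨l, hl, m, hm, h₁, h₂, h₃, h₄, h⟩
  exact ⟨m, hm, l, hl, h₃, h₄, h₁, h₂, parallel_symm h⟩

theorem Para.swap {X Y Z W : Pt} : 𝒜.Para X Y Z W → 𝒜.Para Y X W Z := by
  rintro ⟨l, hl, m, hm, h₁, h₂, h₃, h₄, h⟩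
  exact ⟨l, hl, m, hm, h₂, h₁, h₄, h₃, h⟩

/-- A degenerate pair is parallel to every pair, so the middle pair must be distinct. -/
theorem Para.trans {X Y Z W U V : Pt} (hne : Z ≠ W) :
    𝒜.Para X Y Z W → 𝒜.Para Z W U V → 𝒜.Para X Y U V := by
  rintro ⟨l, hl, m, hm, h₁, h₂, h₃, h₄, h⟩ ⟨l', hl', m', hm', k₁, k₂, k₃, k₄, k⟩
  obtain rfl := 𝒜.line_eq hne hm hl' h₃ h₄ k₁ k₂
  exact ⟨l, hl, m', hm', h₁, h₂, k₃, k₄, 𝒜.parallel_trans hl hm hm' h k⟩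

theorem Para.parallel {X Y Z W : Pt} {l m : Set Pt} (h : 𝒜.Para X Y Z W)
    (hXY : X ≠ Y) (hZW : Z ≠ W) (hl : l ∈ 𝒜.lines) (hm : m ∈ 𝒜.lines)
    (hX : X ∈ l) (hY : Y ∈ l) (hZ : Z ∈ m) (hW : W ∈ m) : Parallel l m := by
  obtain ⟨l', hl', m', hm', k₁, k₂, k₃, k₄, k⟩ := h
  obtain rfl := 𝒜.line_eq hXY hl hl' hX hY k₁ k₂
  obtain rfl := 𝒜.line_eq hZW hm hm' hZ hW k₃ k₄
  exact k

theorem Para.mem {X Y Z W : Pt} {l m : Set Pt} (h : 𝒜.Para X Y Z W) (hXY : X ≠ Y)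
    (hl : l ∈ 𝒜.lines) (hm : m ∈ 𝒜.lines) (hX : X ∈ l) (hY : Y ∈ l) (hlm : Parallel l m)
    (hZ : Z ∈ m) : W ∈ m := by
  by_cases hZW : Z = W
  · exact hZW ▸ hZ
  obtain ⟨l', hl', m', hm', k₁, k₂, k₃, k₄, k⟩ := h
  obtain rfl := 𝒜.line_eq hXY hl hl' hX hY k₁ k₂
  rwa [eq_of_parallel (𝒜.parallel_trans hm hl hm' (parallel_symm hlm) k) hZ k₃]

theorem mem_par_iff {l : Set Pt} (hl : l ∈ 𝒜.lines) {X Y : Pt} :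
    Y ∈ 𝒜.par l X ↔ ∃ m ∈ 𝒜.lines, X ∈ m ∧ Y ∈ m ∧ Parallel l m := by
  obtain ⟨h₁, h₂, h₃⟩ := 𝒜.par_spec X hl
  refine ⟨fun h => ⟨_, h₁, h₂, h, parallel_symm h₃⟩, ?_⟩
  rintro ⟨m, hm, hX, hY, h⟩
  rwa [eq_of_parallel (𝒜.parallel_trans h₁ hl hm h₃ h) h₂ hX]

theorem mem_par_join_iff {X Y Z W : Pt} (h : X ≠ Y) :
    W ∈ 𝒜.par (𝒜.join X Y) Z ↔ 𝒜.Para X Y Z W := by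
  obtain ⟨h₁, h₂, h₃⟩ := 𝒜.join_spec h
  rw [mem_par_iff h₁]
  refine ⟨fun ⟨m, hm, hX, hY, k⟩ => ⟨_, h₁, m, hm, h₂, h₃, hX, hY, k⟩, ?_⟩
  rintro ⟨l, hl, m, hm, k₁, k₂, k₃, k₄, k⟩
  exact ⟨m, hm, k₃, k₄, by rwa [𝒜.line_eq h h₁ hl h₂ h₃ k₁ k₂]⟩

theorem mem_par_join_iff_swap {B X C Y : Pt} (h : B ≠ X) :
    C ∈ 𝒜.par (𝒜.join B X) Y ↔ 𝒜.Para B X C Y := by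
  obtain ⟨j₁, j₂, j₃⟩ := 𝒜.join_spec h
  rw [mem_par_iff j₁]
  refine ⟨fun ⟨m, hm, hX, hY, k⟩ => ⟨_, j₁, m, hm, j₂, j₃, hY, hX, k⟩, ?_⟩
  rintro ⟨l, hl, m, hm, k₁, k₂, k₃, k₄, k⟩
  exact ⟨m, hm, k₄, k₃, by rwa [𝒜.line_eq h j₁ hl j₂ j₃ k₁ k₂]⟩

theorem Para.of_mem {X Y Z W : Pt} {l : Set Pt} (hl : l ∈ 𝒜.lines) (hX : X ∈ l) (hY : Y ∈ l)
    (hZ : Z ∈ l) (hW : W ∈ l) : 𝒜.Para X Y Z W :=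
  ⟨l, hl, l, hl, hX, hY, hZ, hW, Or.inl rfl⟩

theorem Para.refl (X Y : Pt) (h : X ≠ Y) : 𝒜.Para X Y X Y := by
  obtain ⟨h₁, h₂, h₃⟩ := 𝒜.join_spec h
  exact Para.of_mem h₁ h₂ h₃ h₂ h₃

theorem ne_of_parallel {l m : Set Pt} {X Y : Pt} (h : Parallel l m) (hne : l ≠ m) (hX : X ∈ l)
    (hY : Y ∈ m) : X ≠ Y := by
  rintro rfl
  exact hne (eq_of_parallel h hX hY)

theorem eq_of_mem {l m : Set Pt} {X Y : Pt} (hl : l ∈ 𝒜.lines) (hm : m ∈ 𝒜.lines)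
    (hne : l ≠ m) (hXl : X ∈ l) (hXm : X ∈ m) (hYl : Y ∈ l) (hYm : Y ∈ m) : X = Y := by
  by_contra h
  exact hne (𝒜.line_eq h hl hm hXl hYl hXm hYm)

/-- Desargues' axiom for three parallel lines. -/
theorem IsDesarguesian.para (h𝒜 : 𝒜.IsDesarguesian) {a b c : Set Pt} (ha : a ∈ 𝒜.lines)
    (hb : b ∈ 𝒜.lines) (hc : c ∈ 𝒜.lines) (hab : a ≠ b) (hbc : b ≠ c) (hac : a ≠ c)
    (pab : Parallel a b) (pbc : Parallel b c) {A A' B B' C C' : Pt}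
    (hA : A ∈ a) (hA' : A' ∈ a) (hB : B ∈ b) (hB' : B' ∈ b) (hC : C ∈ c) (hC' : C' ∈ c)
    (h₁ : 𝒜.Para A B A' B') (h₂ : 𝒜.Para B C B' C') : 𝒜.Para A C A' C' := by
  have pac := 𝒜.parallel_trans ha hb hc pab pbc
  obtain ⟨d₁, d₂, d₃⟩ := 𝒜.join_spec (ne_of_parallel pab hab hA hB)
  obtain ⟨d₁', d₂', d₃'⟩ := 𝒜.join_spec (ne_of_parallel pab hab hA' hB')
  obtain ⟨e₁, e₂, e₃⟩ := 𝒜.join_spec (ne_of_parallel pbc hbc hB hC)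
  obtain ⟨e₁', e₂', e₃'⟩ := 𝒜.join_spec (ne_of_parallel pbc hbc hB' hC')
  obtain ⟨f₁, f₂, f₃⟩ := 𝒜.join_spec (ne_of_parallel pac hac hA hC)
  obtain ⟨f₁', f₂', f₃'⟩ := 𝒜.join_spec (ne_of_parallel pac hac hA' hC')
  refine ⟨_, f₁, _, f₁', f₂, f₃, f₂', f₃', ?_⟩
  exact h𝒜 a ha b hb c hc hab hbc hac A hA A' hA' B hB B' hB' C hC C' hC' (Or.inl ⟨pab, pbc⟩)
    (h₁.parallel (ne_of_parallel pab hab hA hB) (ne_of_parallel pab hab hA' hB') d₁ d₁' d₂ d₃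
      d₂' d₃')
    (h₂.parallel (ne_of_parallel pbc hbc hB hC) (ne_of_parallel pbc hbc hB' hC') e₁ e₁' e₂ e₃
      e₂' e₃')

/-! ### Dilatations and their traces. -/

variable (𝒜) in
/-- An injective map of the plane carrying every line into a parallel line. -/
def IsDilatation (f : Pt → Pt) : Prop :=
  Function.Injective f ∧ ∀ X Y, X ≠ Y → 𝒜.Para X Y (f X) (f Y)

theorem IsDilatation.comp {f g : Pt → Pt} (hf : 𝒜.IsDilatation f) (hg : 𝒜.IsDilatation g) :
    𝒜.IsDilatation (f ∘ g) :=
  ⟨hf.1.comp hg.1, fun X Y h => (hg.2 X Y h).trans (hg.1.ne h) (hf.2 _ _ (hg.1.ne h))⟩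

theorem IsDilatation.mem_trace {f : Pt → Pt} (hf : 𝒜.IsDilatation f) {l : Set Pt}
    (hl : l ∈ 𝒜.lines) {X Y : Pt} (hX : X ∈ l) (hfX : f X ∈ l) (hY : Y ∈ l) : f Y ∈ l := by
  by_cases h : X = Y
  · exact h ▸ hfX
  · exact (hf.2 X Y h).mem h hl hl hX hY (Or.inl rfl) hfX

/-- The traces of a dilatation without fixed points are parallel. -/
theorem IsDilatation.para_trace {f : Pt → Pt} (hf : 𝒜.IsDilatation f) (hfix : ∀ X, f X ≠ X)
    (X Y : Pt) : 𝒜.Para X (f X) Y (f Y) := by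
  obtain ⟨h₁, h₂, h₃⟩ := 𝒜.join_spec (hfix X).symm
  obtain ⟨k₁, k₂, k₃⟩ := 𝒜.join_spec (hfix Y).symm
  refine ⟨_, h₁, _, k₁, h₂, h₃, k₂, k₃, ?_⟩
  by_contra hn
  obtain ⟨hne, hd⟩ := not_or.1 hn
  obtain ⟨Z, hZ, hZ'⟩ := Set.nonempty_iff_ne_empty.2 hd
  -- Each trace is mapped into itself, so a common point of two distinct traces would be fixed.
  exact hfix Z (eq_of_mem h₁ k₁ hne (hf.mem_trace h₁ h₂ h₃ hZ) (hf.mem_trace k₁ k₂ k₃ hZ') hZ hZ')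

/-! ### Parallelograms with a side on OI. -/

namespace Frame

variable (F : 𝒜.Frame)

/-- The point `Y` is obtained from the point `X` off the line `OI` by completing the
parallelogram `O A Y X`. -/
def IsTranslate (A X Y : Pt) : Prop :=
  X ∉ F.line ∧ Y ∈ 𝒜.par F.line X ∧ 𝒜.Para F.O X A Y

variable {F}

theorem ne_of_notMem {X Y : Pt} (hX : X ∈ F.line) (hY : Y ∉ F.line) : X ≠ Y := by
  rintro rfl
  exact hY hX

theorem mem_par_line {X : Pt} : X ∈ 𝒜.par F.line X := (𝒜.par_spec X F.line_mem).2.1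

theorem par_line_eq {X Y : Pt} (h : Y ∈ 𝒜.par F.line X) : 𝒜.par F.line X = 𝒜.par F.line Y := by
  obtain ⟨h₁, h₂, h₃⟩ := 𝒜.par_spec X F.line_mem
  obtain ⟨k₁, k₂, k₃⟩ := 𝒜.par_spec Y F.line_mem
  exact eq_of_parallel (𝒜.parallel_trans h₁ F.line_mem k₁ h₃ (parallel_symm k₃)) h k₂

theorem par_line_ne {X : Pt} (h : X ∉ F.line) : 𝒜.par F.line X ≠ F.line :=
  fun e => h (e ▸ mem_par_line)

theorem par_line_parallel (X Y : Pt) : Parallel (𝒜.par F.line X) (𝒜.par F.line Y) := by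
  obtain ⟨h₁, h₂, h₃⟩ := 𝒜.par_spec X F.line_mem
  obtain ⟨k₁, k₂, k₃⟩ := 𝒜.par_spec Y F.line_mem
  exact 𝒜.parallel_trans h₁ F.line_mem k₁ h₃ (parallel_symm k₃)

theorem par_line_mem (X : Pt) : 𝒜.par F.line X ∈ 𝒜.lines := (𝒜.par_spec X F.line_mem).1

theorem notMem_of_mem_par {X Y : Pt} (h : X ∉ F.line) (hY : Y ∈ 𝒜.par F.line X) :
    Y ∉ F.line := fun hY' =>
  par_line_ne h (eq_of_parallel (𝒜.par_spec X F.line_mem).2.2 hY hY')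

theorem IsTranslate.notMem {A X Y : Pt} (h : F.IsTranslate A X Y) : Y ∉ F.line :=
  notMem_of_mem_par h.1 h.2.1

theorem exists_isTranslate {X : Pt} (hX : X ∉ F.line) (A : F.LinePt) :
    ∃ Y, F.IsTranslate A X Y := by
  obtain ⟨Y, h₁, h₂⟩ := exists_sum_P hX A
  exact ⟨Y, hX, h₁, (mem_par_join_iff (ne_of_notMem F.O_mem hX)).1 h₂⟩

/-- A line in the direction of a line meeting `OI` in a single point meets every parallel of `OI`
at most once. -/
theorem eq_of_para {X Y A P Q : Pt} (hX : X ∈ F.line) (hY : Y ∉ F.line)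
    (hP : 𝒜.Para X Y A P) (hQ : 𝒜.Para X Y A Q) (hPQ : Q ∈ 𝒜.par F.line P) : P = Q := by
  have hne := ne_of_notMem hX hY
  obtain ⟨j₁, j₂, j₃, j₄⟩ := join_aux hX hY
  obtain ⟨k₁, k₂, k₃⟩ := 𝒜.par_spec A j₁
  rw [← mem_par_join_iff hne] at hP hQ
  refine eq_of_mem k₁ (par_line_mem (F := F) P) (fun e => ?_) hP mem_par_line hQ hPQ
  rw [e] at k₃
  exact j₄ (eq_of_parallel (𝒜.parallel_trans j₁ (par_line_mem P) F.line_mem (parallel_symm k₃)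
    (𝒜.par_spec P F.line_mem).2.2) j₂ hX)

theorem IsTranslate.unique {A X Y Y' : Pt} (h : F.IsTranslate A X Y)
    (h' : F.IsTranslate A X Y') : Y = Y' :=
  eq_of_para F.O_mem h.1 h.2.2 h'.2.2 (par_line_eq h.2.1 ▸ h'.2.1)

theorem isTranslate_zero {X : Pt} (h : X ∉ F.line) : F.IsTranslate F.O X X :=
  ⟨h, mem_par_line, Para.refl _ _ (ne_of_notMem F.O_mem h)⟩

theorem IsTranslate.eq_zero {A X : Pt} (hA : A ∈ F.line) (h : F.IsTranslate A X X) :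
    A = F.O := by
  obtain ⟨j₁, j₂, j₃, j₄⟩ := join_aux F.O_mem h.1
  exact eq_of_mem j₁ F.line_mem j₄
    (h.2.2.swap.mem (ne_of_notMem F.O_mem h.1).symm j₁ j₁ j₃ j₂ (Or.inl rfl) j₃) hA j₂ F.O_mem

/-- Desargues for the triangles X O X' and Y A Y', with OI as the middle one of the three parallels.
-/
theorem IsTranslate.para (h𝒜 : 𝒜.IsDesarguesian) {A X Y X' Y' : Pt} (hA : A ∈ F.line)
    (h : F.IsTranslate A X Y) (h' : F.IsTranslate A X' Y') : 𝒜.Para X X' Y Y' := by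
  by_cases e : X' ∈ 𝒜.par F.line X
  · exact Para.of_mem (par_line_mem (F := F) X) mem_par_line e h.2.1 (par_line_eq e ▸ h'.2.1)
  · refine h𝒜.para (par_line_mem (F := F) X) F.line_mem (par_line_mem (F := F) X')
      (par_line_ne h.1) (par_line_ne h'.1).symm (fun k => e (k ▸ mem_par_line))
      (𝒜.par_spec X F.line_mem).2.2 (parallel_symm (𝒜.par_spec X' F.line_mem).2.2)
      mem_par_line h.2.1 F.O_mem hA mem_par_line h'.2.1 h.2.2.swap h'.2.2

/-! ### Independence of the sum from the auxiliary point. -/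

theorem sum_aux_of_notMem (h𝒜 : 𝒜.IsDesarguesian) {A B C X Y X' Y' : Pt} (hA : A ∈ F.line)
    (hB : B ∈ F.line) (hC : C ∈ F.line) (h : F.IsTranslate A X Y) (h' : F.IsTranslate A X' Y')
    (e : X' ∉ 𝒜.par F.line X) (hs : 𝒜.Para B X C Y) : 𝒜.Para B X' C Y' :=
  h𝒜.para F.line_mem (par_line_mem (F := F) X) (par_line_mem (F := F) X')
    (par_line_ne h.1).symm (fun k => e (k ▸ mem_par_line)) (par_line_ne h'.1).symm
    (parallel_symm (𝒜.par_spec X F.line_mem).2.2) (par_line_parallel X X')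
    hB hC mem_par_line h.2.1 mem_par_line h'.2.1 hs (h.para h𝒜 hA h')

/-- If the plane consists of two parallel lines, then each of them has two points. -/
theorem eq_of_order_two {X A B : Pt} (hA : A ∈ F.line) (hB : B ∈ F.line)
    (hX : X ∉ F.line) (hall : ∀ Z, Z ∈ F.line ∨ Z ∈ 𝒜.par F.line X) (hA0 : A ≠ F.O)
    (hB0 : B ≠ F.O) : A = B := by
  obtain ⟨j₁, j₂, j₃, j₄⟩ := join_aux F.O_mem hX
  obtain ⟨k₁, k₂, k₃, k₄⟩ := join_aux hB hX
  obtain ⟨p₁, p₂, p₃⟩ := 𝒜.par_spec A j₁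
  -- Z is where BX meets the parallel to OX through A. On OI it equals both A and B; on the other
  -- line it equals X, which forces A = O.
  obtain ⟨Z, hZ, hZ'⟩ := 𝒜.exists_meet k₁ j₁ k₁ p₁ k₃ j₃
    (fun e => hB0 (eq_of_mem j₁ F.line_mem j₄ (e ▸ k₂) hB j₂ F.O_mem)) (Or.inl rfl) p₃
  rcases hall Z with h | h
  · have e₁ := eq_of_mem k₁ F.line_mem k₄ hZ h k₂ hB
    have hp : 𝒜.par (𝒜.join F.O X) A ≠ F.line := fun e => by
      rw [e] at p₃
      exact j₄ (eq_of_parallel p₃ F.O_mem j₂).symm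
    have e₂ := eq_of_mem p₁ F.line_mem hp hZ' h p₂ hA
    exact e₂.symm.trans e₁
  · have e₁ : Z = X := eq_of_mem k₁ (par_line_mem (F := F) X)
      (fun e => notMem_of_mem_par hX (e ▸ k₂) hB) hZ h k₃ mem_par_line
    have : F.IsTranslate A X X :=
      ⟨hX, mem_par_line, (mem_par_join_iff (ne_of_notMem F.O_mem hX)).1 (e₁ ▸ hZ')⟩
    exact absurd (this.eq_zero hA) hA0

/-- The point of the addition construction does not depend on the auxiliary point. -/
theorem sum_aux_unique (h𝒜 : 𝒜.IsDesarguesian) {A B C C' X Y X' Y' : Pt} (hA : A ∈ F.line)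
    (hB : B ∈ F.line) (hC : C ∈ F.line) (hC' : C' ∈ F.line) (h : F.IsTranslate A X Y)
    (h' : F.IsTranslate A X' Y') (hs : 𝒜.Para B X C Y) (hs' : 𝒜.Para B X' C' Y') : C = C' := by
  have key : ∀ {C C' X Y : Pt}, C ∈ F.line → C' ∈ F.line → X ∉ F.line → Y ∉ F.line →
      𝒜.Para B X C Y → 𝒜.Para B X C' Y → C = C' := by
    intro C C' X Y hC hC' hX hY h₁ h₂
    obtain ⟨j₁, j₂, j₃, j₄⟩ := join_aux hB hX
    obtain ⟨k₁, k₂, k₃⟩ := 𝒜.par_spec Y j₁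
    have hne := ne_of_notMem hB hX
    exact eq_of_mem k₁ F.line_mem (fun e => hY (e ▸ k₂)) ((mem_par_join_iff_swap hne).2 h₁) hC
      ((mem_par_join_iff_swap hne).2 h₂) hC'
  by_cases e : X' ∈ 𝒜.par F.line X
  swap
  · exact key hC hC' h'.1 h'.notMem (sum_aux_of_notMem h𝒜 hA hB hC h h' e hs) hs'
  -- With X and X' on one parallel of OI, Desargues does not apply directly; a point Z off both
  -- lines serves as an intermediate auxiliary point.
  by_cases hall : ∀ Z, Z ∈ F.line ∨ Z ∈ 𝒜.par F.line X
  swap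
  · push Not at hall
    obtain ⟨Z, hZ, hZ'⟩ := hall
    obtain ⟨W, hW⟩ := exists_isTranslate hZ ⟨A, hA⟩
    have h₁ := sum_aux_of_notMem h𝒜 hA hB hC h hW hZ' hs
    refine key hC hC' h'.1 h'.notMem (sum_aux_of_notMem h𝒜 hA hB hC hW h' (fun k => ?_) h₁) hs'
    have := par_line_eq e
    rw [this, ← par_line_eq k] at hZ'
    exact hZ' mem_par_line
  -- No such Z exists: apart from the trivial sums with O, A and B are the only nonzero point of OI,
  -- and the construction must give O.
  by_cases hA0 : A = F.O
  · subst hA0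
    obtain rfl := h.unique (isTranslate_zero h.1)
    obtain rfl := h'.unique (isTranslate_zero h'.1)
    have e₁ := key hC hB h.1 h.1 hs (Para.refl _ _ (ne_of_notMem hB h.1))
    have e₂ := key hC' hB h'.1 h'.1 hs' (Para.refl _ _ (ne_of_notMem hB h'.1))
    rw [e₁, e₂]
  by_cases hB0 : B = F.O
  · subst hB0
    rw [key hC hA h.1 h.notMem hs h.2.2, key hC' hA h'.1 h'.notMem hs' h'.2.2]
  have two : ∀ Z ∈ F.line, Z ≠ F.O → A = Z := fun Z hZ hZ0 =>
    eq_of_order_two hA hZ h.1 hall hA0 hZ0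
  obtain rfl := two B hB hB0
  have zero : ∀ {C X Y : Pt}, C ∈ F.line → F.IsTranslate A X Y → 𝒜.Para A X C Y → C = F.O := by
    intro C X Y hC h hs
    by_contra hC0
    obtain rfl := two C hC hC0
    obtain rfl := eq_of_para hB h.1 hs (Para.refl _ _ (ne_of_notMem hB h.1))
      (par_line_eq h.2.1 ▸ mem_par_line)
    exact hA0 (h.eq_zero hA)
  rw [zero hC h hs, zero hC' h' hs']

theorem isSum_iff {A B C : F.LinePt} :
    F.IsSum A B C ↔ ∃ X Y, F.IsTranslate A X Y ∧ 𝒜.Para B.1 X C.1 Y := by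
  constructor
  · rintro ⟨X, Y, hX, h₁, h₂, h₃⟩
    exact ⟨X, Y, ⟨hX, h₁, (mem_par_join_iff (ne_of_notMem F.O_mem hX)).1 h₂⟩,
      (mem_par_join_iff_swap (ne_of_notMem B.2 hX)).1 h₃⟩
  · rintro ⟨X, Y, ⟨hX, h₁, h₂⟩, h₃⟩
    exact ⟨X, Y, hX, h₁, (mem_par_join_iff (ne_of_notMem F.O_mem hX)).2 h₂,
      (mem_par_join_iff_swap (ne_of_notMem B.2 hX)).2 h₃⟩

theorem isSum_add (A B : F.LinePt) : F.IsSum A B (A + B) := (F.exists_isSum A B).choose_spec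

theorem IsSum.eq_add (h𝒜 : 𝒜.IsDesarguesian) {A B C : F.LinePt} (h : F.IsSum A B C) :
    C = A + B := by
  obtain ⟨X, Y, h₁, h₂⟩ := isSum_iff.1 h
  obtain ⟨X', Y', h₁', h₂'⟩ := isSum_iff.1 (isSum_add A B)
  exact Subtype.ext (sum_aux_unique h𝒜 A.2 B.2 C.2 (A + B).2 h₁ h₁' h₂ h₂')

theorem add_eq_of_para (h𝒜 : 𝒜.IsDesarguesian) {A B C : F.LinePt} {X Y : Pt}
    (h : F.IsTranslate A X Y) (hs : 𝒜.Para B.1 X C.1 Y) : A + B = C :=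
  ((isSum_iff.2 ⟨X, Y, h, hs⟩).eq_add h𝒜).symm

/-- Any auxiliary point gives the sum. -/
theorem IsTranslate.para_add (h𝒜 : 𝒜.IsDesarguesian) {A : F.LinePt} {X Y : Pt}
    (h : F.IsTranslate A X Y) (B : F.LinePt) : 𝒜.Para B.1 X (A + B : F.LinePt).1 Y := by
  obtain ⟨C, hC⟩ := exists_last Y B.2 h.1
  have hs := (mem_par_join_iff_swap (ne_of_notMem B.2 h.1)).1 hC
  rwa [add_eq_of_para h𝒜 h hs]

/-! ### The additive group of OI. -/

theorem IsTranslate.trans (h𝒜 : 𝒜.IsDesarguesian) {A B : F.LinePt} {X Y Z : Pt}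
    (h : F.IsTranslate B X Y) (h' : F.IsTranslate A Y Z) :
    F.IsTranslate (A + B : F.LinePt) X Z :=
  ⟨h.1, par_line_eq h.2.1 ▸ h'.2.1,
    h.2.2.trans (ne_of_notMem B.2 h.notMem) (h'.para_add h𝒜 B)⟩

protected theorem add_assoc (h𝒜 : 𝒜.IsDesarguesian) (A B C : F.LinePt) :
    A + B + C = A + (B + C) := by
  obtain ⟨X, hX⟩ := F.exists_notMem_line
  obtain ⟨Y, hY⟩ := exists_isTranslate hX B
  obtain ⟨Z, hZ⟩ := exists_isTranslate hY.notMem A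
  refine add_eq_of_para h𝒜 (hY.trans h𝒜 hZ) ?_
  -- X goes to Y by B and to Z by A: the lines from C to X, from B + C to Y and from A + (B + C) to
  -- Z are parallel.
  exact (hY.para_add h𝒜 C).trans (ne_of_notMem (B + C).2 hY.notMem) (hZ.para_add h𝒜 _)

protected theorem zero_add (h𝒜 : 𝒜.IsDesarguesian) (A : F.LinePt) : 0 + A = A := by
  obtain ⟨X, hX⟩ := F.exists_notMem_line
  exact add_eq_of_para h𝒜 (isTranslate_zero hX) (Para.refl _ _ (ne_of_notMem A.2 hX))

protected theorem add_zero (h𝒜 : 𝒜.IsDesarguesian) (A : F.LinePt) : A + 0 = A := by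
  obtain ⟨X, hX⟩ := F.exists_notMem_line
  obtain ⟨Y, hY⟩ := exists_isTranslate hX A
  exact add_eq_of_para h𝒜 hY hY.2.2

protected theorem add_neg (h𝒜 : 𝒜.IsDesarguesian) (A : F.LinePt) : A + -A = 0 :=
  (IsSum.eq_add h𝒜 (F.exists_isSum_zero A).choose_spec).symm

protected theorem neg_add (h𝒜 : 𝒜.IsDesarguesian) (A : F.LinePt) : -A + A = 0 := by
  rw [← Frame.add_zero h𝒜 (-A + A), ← Frame.add_neg h𝒜 (-A), Frame.add_assoc h𝒜,
    ← Frame.add_assoc h𝒜 A, Frame.add_neg h𝒜, Frame.zero_add h𝒜]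

/-! ### Translations of the plane and commutativity. -/

open Classical in
/-- The translation of the plane carrying `O` to the point `A` of the line `OI`. -/
noncomputable def translate (A : F.LinePt) (X : Pt) : Pt :=
  if h : X ∈ F.line then (A + ⟨X, h⟩ : F.LinePt).1 else (exists_isTranslate h A).choose

theorem translate_coe (A B : F.LinePt) : translate A B = (A + B : F.LinePt).1 :=
  dif_pos B.2

theorem isTranslate_translate (A : F.LinePt) {X : Pt} (h : X ∉ F.line) :
    F.IsTranslate A X (translate A X) := by
  rw [translate, dif_neg h]
  exact (exists_isTranslate h A).choose_spec

theorem translate_translate (h𝒜 : 𝒜.IsDesarguesian) (A B : F.LinePt) (X : Pt) :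
    translate A (translate B X) = translate (A + B) X := by
  by_cases h : X ∈ F.line
  · lift X to F.LinePt using h
    rw [translate_coe, translate_coe, translate_coe, Frame.add_assoc h𝒜]
  · have h₁ := isTranslate_translate B h
    exact (h₁.trans h𝒜 (isTranslate_translate A h₁.notMem)).unique (isTranslate_translate _ h)

theorem translate_zero (h𝒜 : 𝒜.IsDesarguesian) (X : Pt) : translate (0 : F.LinePt) X = X := by
  by_cases h : X ∈ F.line
  · lift X to F.LinePt using h
    rw [translate_coe, Frame.zero_add h𝒜]
  · exact (isTranslate_translate 0 h).unique (isTranslate_zero h)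

theorem isDilatation_translate (h𝒜 : 𝒜.IsDesarguesian) (A : F.LinePt) :
    𝒜.IsDilatation (translate A) := by
  refine ⟨Function.LeftInverse.injective (g := translate (-A)) fun X => by
    rw [translate_translate h𝒜, Frame.neg_add h𝒜, translate_zero h𝒜], fun X Y _ => ?_⟩
  by_cases hX : X ∈ F.line <;> by_cases hY : Y ∈ F.line
  · lift X to F.LinePt using hX
    lift Y to F.LinePt using hY
    rw [translate_coe, translate_coe]
    exact Para.of_mem F.line_mem X.2 Y.2 (A + X).2 (A + Y).2
  · lift X to F.LinePt using hX
    rw [translate_coe]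
    exact (isTranslate_translate A hY).para_add h𝒜 X
  · lift Y to F.LinePt using hY
    rw [translate_coe]
    exact ((isTranslate_translate A hX).para_add h𝒜 Y).swap
  · exact (isTranslate_translate A hX).para h𝒜 A.2 (isTranslate_translate A hY)

theorem translate_mem_par (A : F.LinePt) (X : Pt) : translate A X ∈ 𝒜.par F.line X := by
  by_cases h : X ∈ F.line
  · lift X to F.LinePt using h
    rw [translate_coe, mem_par_iff F.line_mem]
    exact ⟨_, F.line_mem, X.2, (A + X).2, Or.inl rfl⟩
  · exact (isTranslate_translate A h).2.1

theorem translate_ne (h𝒜 : 𝒜.IsDesarguesian) {A : F.LinePt} (hA : A ≠ 0) (X : Pt) :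
    translate A X ≠ X := by
  intro e
  by_cases h : X ∈ F.line
  · lift X to F.LinePt using h
    rw [translate_coe] at e
    have e' : A + X = X := Subtype.ext e
    apply hA
    rw [← Frame.add_zero h𝒜 A, ← Frame.add_neg h𝒜 X, ← Frame.add_assoc h𝒜, e']
  · have h₁ := isTranslate_translate A h
    rw [e] at h₁
    exact hA (Subtype.ext (h₁.eq_zero A.2))

protected theorem add_comm (h𝒜 : 𝒜.IsDesarguesian) (A B : F.LinePt) : A + B = B + A := by
  obtain ⟨X, hX⟩ := F.exists_notMem_line
  obtain ⟨j₁, j₂, j₃, j₄⟩ := join_aux F.O_mem hX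
  -- A second frame with the same zero and axis OX makes the results on translations available in
  -- that direction.
  let G : 𝒜.Frame := ⟨F.O, X, ne_of_notMem F.O_mem hX⟩
  have hG : G.line = 𝒜.join F.O X := rfl
  have hG1 : (1 : G.LinePt) ≠ 0 := fun e => G.ne (congrArg Subtype.val e).symm
  have hGO : translate (1 : G.LinePt) F.O = X := by
    have := translate_coe (1 : G.LinePt) 0
    rwa [Frame.add_zero h𝒜] at this
  have hA := isTranslate_translate A hX
  -- Both sides are the fourth vertex of the parallelogram on OA and OX.
  have hGA : translate (1 : G.LinePt) A.1 = translate A X := by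
    by_cases hA0 : A = 0
    · subst hA0
      rw [translate_zero h𝒜]
      exact hGO
    have hAG : A.1 ∉ G.line := fun h =>
      hA0 (Subtype.ext (eq_of_mem j₁ F.line_mem j₄ h A.2 j₂ F.O_mem))
    refine (isTranslate_translate (1 : G.LinePt) hAG).unique ⟨hAG, ?_, ?_⟩
    · rw [hG, mem_par_join_iff (ne_of_notMem F.O_mem hX)]
      exact hA.2.2
    · exact ⟨_, F.line_mem, _, par_line_mem (F := F) X, F.O_mem, A.2, mem_par_line, hA.2.1,
        parallel_symm (𝒜.par_spec X F.line_mem).2.2⟩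
  have hf := (isDilatation_translate h𝒜 B).comp (isDilatation_translate h𝒜 (1 : G.LinePt))
  -- If the composite fixed Z, then Z and its image under the first translation would lie on
  -- parallels to both OX and OI, hence coincide.
  have hfix : ∀ Z, (translate B ∘ translate (1 : G.LinePt)) Z ≠ Z := by
    intro Z hZ
    refine translate_ne h𝒜 hG1 Z ?_
    have h₁ := translate_mem_par (1 : G.LinePt) Z
    have h₂ := translate_mem_par B (translate (1 : G.LinePt) Z)
    rw [show translate B (translate (1 : G.LinePt) Z) = Z from hZ] at h₂
    refine eq_of_mem (par_line_mem (F := G) Z) (par_line_mem (F := F) _) (fun e => j₄ ?_)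
      h₁ mem_par_line mem_par_line h₂
    have p₁ := (𝒜.par_spec Z G.line_mem).2.2
    rw [e] at p₁
    exact eq_of_parallel (𝒜.parallel_trans G.line_mem (par_line_mem (F := F) _) F.line_mem
      (parallel_symm p₁) (𝒜.par_spec _ F.line_mem).2.2) j₂ F.O_mem
  -- The composite sends O to the B-translate of X, and A to the B-translate of the A-translate of
  -- X. Parallel traces complete the parallelogram that defines the A-translate of the first image.
  have htr := hf.para_trace hfix F.O A.1
  simp only [Function.comp_apply, hGO, hGA] at htr
  have hB := isTranslate_translate B hX
  have hBA := isTranslate_translate B hA.notMem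
  have e : translate A (translate B X) = translate B (translate A X) :=
    (isTranslate_translate A hB.notMem).unique
      ⟨hB.notMem, par_line_eq hB.2.1 ▸ par_line_eq hA.2.1 ▸ hBA.2.1, htr⟩
  rw [translate_translate h𝒜, translate_translate h𝒜] at e
  have h₁ := isTranslate_translate (A + B) hX
  have h₂ := isTranslate_translate (B + A) hX
  rw [← e] at h₂
  rw [← Frame.add_zero h𝒜 (A + B)]
  exact add_eq_of_para h𝒜 h₁ h₂.2.2

/-! ### Differences and the cross-ratio. -/

protected theorem add_left_cancel (h𝒜 : 𝒜.IsDesarguesian) {P A B : F.LinePt}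
    (h : P + A = P + B) : A = B := by
  have := congrArg (-P + ·) h
  simpa only [← Frame.add_assoc h𝒜, Frame.neg_add h𝒜, Frame.zero_add h𝒜] using this

protected theorem add_sub_add_right (h𝒜 : 𝒜.IsDesarguesian) (A B P : F.LinePt) :
    (A + P) - (B + P) = A - B := by
  -- In this reversed order the inner terms cancel without commutativity.
  have hn : -(B + P) = -P + -B := by
    apply Frame.add_left_cancel h𝒜 (P := B + P)
    rw [Frame.add_neg h𝒜, Frame.add_assoc h𝒜, ← Frame.add_assoc h𝒜 P, Frame.add_neg h𝒜,
      Frame.zero_add h𝒜, Frame.add_neg h𝒜]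
  change A + P + -(B + P) = A + -B
  rw [hn, Frame.add_assoc h𝒜, ← Frame.add_assoc h𝒜 P, Frame.add_neg h𝒜, Frame.zero_add h𝒜]

theorem crossRatio_add_right (h𝒜 : 𝒜.IsDesarguesian) (P A B C D : F.LinePt) :
    crossRatio (A + P) (B + P) (C + P) (D + P) = crossRatio A B C D := by
  simp only [crossRatio, Frame.add_sub_add_right h𝒜]

end Frame

end AffinePlane

theorem mainTheorem6 {Pt : Type*} (𝒜 : AffinePlane Pt) (h𝒜 : 𝒜.IsDesarguesian)
    (F : 𝒜.Frame) (P A B C D : F.LinePt) (hAD : A ≠ D) (hBC : B ≠ C) :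
    AffinePlane.Frame.natTranslation P A ≠ AffinePlane.Frame.natTranslation P D ∧
    AffinePlane.Frame.natTranslation P B ≠ AffinePlane.Frame.natTranslation P C ∧
    AffinePlane.Frame.crossRatio
        (AffinePlane.Frame.natTranslation P A) (AffinePlane.Frame.natTranslation P B)
        (AffinePlane.Frame.natTranslation P C) (AffinePlane.Frame.natTranslation P D) =
      AffinePlane.Frame.crossRatio A B C D ∧
    AffinePlane.Frame.crossRatio (A + P) (B + P) (C + P) (D + P) =
      AffinePlane.Frame.crossRatio A B C D := by
  refine ⟨fun h => hAD (AffinePlane.Frame.add_left_cancel h𝒜 h),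
    fun h => hBC (AffinePlane.Frame.add_left_cancel h𝒜 h), ?_,
    AffinePlane.Frame.crossRatio_add_right h𝒜 P A B C D⟩
  -- `natTranslation` adds P on the left, whereas differences cancel a right summand.
  simp only [AffinePlane.Frame.natTranslation, AffinePlane.Frame.add_comm h𝒜 P]
  exact AffinePlane.Frame.crossRatio_add_right h𝒜 P A B C D
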